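/- For $x=(x_n)_{n\ge 0}\in\mathbb{C}^{\mathbb{N}_0}$ (where $\mathbb{N}_0=\{0,1,2,\dots\}$) and $n\in\mathbb{N}_0$ put $A_n(x):=\frac{1}{n+1}\sum_{k=0}^n|x_k|$. For $1<p<\infty$ let $ces_p$ be the Banach space of all $x\in\mathbb{C}^{\mathbb{N}_0}$ with $\|x\|_{ces_p}:=\bigl(\sum_{n=0}^\infty A_n(x)^p\bigr)^{1/p}<\infty$; let $ces_\infty$ be the Banach space of all $x$ with $\|x\|_{ces_\infty}:=\sup_{n}A_n(x)<\infty$; and let $ces_0$ be its closed subspace of all $x$ with $A_n(x)\to 0$, with the norm of $ces_\infty$. For $t\in[0,1)$ let $C_t$ be the generalized Cesàro operator $$(C_tx)_n:=\frac{t^nx_0+t^{n-1}x_1+\dots+x_n}{n+1},\qquad n\in\mathbb{N}_0,$$ and let $\Lambda:=\{\frac1{n+1}: n\in\mathbb{N}_0\}$, $\Lambda_0:=\Lambda\cup\{0\}$. For a continuous linear operator $T$ on a Banach space $X$ over $\mathbb{C}$, $\sigma(T;X)$ is its spectrum and $\sigma_{pt}(T;X)$ its set of eigenvalues; $T$ is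 power bounded if $\sup_{n\ge1}\|T^n\|<\infty$, uniformly mean ergodic if $\frac1n\sum_{m=1}^nT^m$ converges in operator norm as $n\to\infty$, and supercyclic if there is $x\in X$ such that $\{\lambda T^nx:\lambda\in\mathbb{C},\,n\in\mathbb{N}_0\}$ is dense in $X$. **Proposition.** Let $0\le t<1$. (i) For each $1<p<\infty$, $C_t$ maps $ces_p$ continuously into itself, $\|C_t\|_{ces_p\to ces_p}\le\min\{(1-t)^{-1},\,p/(p-1)\}$, $C_t$ is compact on $ces_p$, and $\sigma_{pt}(C_t;ces_p)=\Lambda$, $\sigma(C_t;ces_p)=\Lambda_0$. Moreover, $C_t$ is power bounded and uniformly mean ergodic in $ces_p$, but not supercyclic. (ii) $C_t$ maps $ces_0$ continuously into itself, $\|C_t\|_{ces_0\to ces_0}=1$, $C_t$ is power bounded and compact on $ces_0$, and $\sigma_{pt}(C_t;ces_0)=\Lambda$, $\sigma(C_t;ces_0)=\Lambda_0$. Moreover, $C_t$ is uniformly mean ergodic in $ces_0$, but not supercyclic. (iii) $C_t$ maps $ces_\infty$ continuously into itself, $\|C_t\|_{ces_\infty\to ces_\infty}=1$, $C_t$ is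 power bounded and compact on $ces_\infty$, and $\sigma_{pt}(C_t;ces_\infty)=\Lambda$, $\sigma(C_t;ces_\infty)=\Lambda_0$. Moreover, $C_t$ is uniformly mean ergodic in $ces_\infty$, but not supercyclic. -/

import Mathlib

open Filter Topology
open scoped ENNReal

noncomputable section

namespace CesaroSeq

/-- The averages `(1/(n+1)) ∑_{k=0}^n |x_k|` of the moduli of a complex sequence. -/
def absAvg (x : ℕ → ℂ) (n : ℕ) : ℝ :=
  (∑ k ∈ Finset.range (n + 1), ‖x k‖) / ((n : ℝ) + 1)

theorem absAvg_nonneg (x : ℕ → ℂ) (n : ℕ) : 0 ≤ absAvg x n := by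
  unfold absAvg; positivity

theorem absAvg_zero : absAvg 0 = 0 := by
  funext n; simp [absAvg]

theorem absAvg_add_le (x y : ℕ → ℂ) (n : ℕ) :
    absAvg (x + y) n ≤ absAvg x n + absAvg y n := by
  unfold absAvg
  rw [← add_div, ← Finset.sum_add_distrib]
  gcongr with k _
  exact norm_add_le _ _

theorem absAvg_smul (c : ℂ) (x : ℕ → ℂ) (n : ℕ) : absAvg (c • x) n = ‖c‖ * absAvg x n := by
  simp [absAvg, ← Finset.mul_sum, mul_div_assoc]

theorem eq_zero_of_absAvg (x : ℕ → ℂ) (h : absAvg x = 0) : x = 0 := by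
  funext n
  have h1 : (∑ k ∈ Finset.range (n + 1), ‖x k‖) / ((n : ℝ) + 1) = 0 := congrFun h n
  have h2 : ∑ k ∈ Finset.range (n + 1), ‖x k‖ = 0 := by
    have : ((n : ℝ) + 1) ≠ 0 := by positivity
    simpa [this] using h1
  have h3 := (Finset.sum_eq_zero_iff_of_nonneg (fun k _ => norm_nonneg (x k))).1 h2 n
    (Finset.self_mem_range_succ n)
  simpa using h3

/-! ### The spaces `ces_p`, `1 ≤ p ≤ ∞` -/

/-- The sequences whose averages of moduli lie in `ℓ^p`. -/
def cesSubmodule (p : ℝ≥0∞) : Submodule ℂ (ℕ → ℂ) where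
  carrier := {x | Memℓp (E := fun _ : ℕ => ℝ) (absAvg x) p}
  zero_mem' := by
    change Memℓp (E := fun _ : ℕ => ℝ) (absAvg 0) p
    rw [absAvg_zero]
    exact zero_memℓp
  add_mem' := by
    intro x y hx hy
    refine Memℓp.mono (Memℓp.add hx hy) fun n => ?_
    rw [Real.norm_of_nonneg (absAvg_nonneg _ n)]
    exact absAvg_add_le x y n
  smul_mem' := by
    intro c x hx
    have h := Memℓp.const_smul (𝕜 := ℝ) (E := fun _ : ℕ => ℝ) hx ‖c‖
    have e : absAvg (c • x) = ‖c‖ • absAvg x := funext fun n => absAvg_smul c x n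
    change Memℓp (E := fun _ : ℕ => ℝ) (absAvg (c • x)) p
    rw [e]
    exact h

/-- The Cesàro space `ces_p`. (A type of its own, so that it does not inherit the topology of
coordinatewise convergence.) -/
def Ces (p : ℝ≥0∞) : Type := cesSubmodule p

namespace Ces

variable {p : ℝ≥0∞}

instance : AddCommGroup (Ces p) := inferInstanceAs (AddCommGroup (cesSubmodule p))

instance : Module ℂ (Ces p) := inferInstanceAs (Module ℂ (cesSubmodule p))

/-- The sequence underlying an element of `ces_p`. -/
def toSeq (x : Ces p) : ℕ → ℂ := x.1

/-- The sequence of averages of moduli, as an element of `ℓ^p`. -/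
def avg (x : Ces p) : lp (fun _ : ℕ => ℝ) p := ⟨absAvg x.toSeq, x.2⟩

/-- `‖x‖_{ces_p}` is the `ℓ^p`-norm of the averages of moduli. -/
instance [Fact (1 ≤ p)] : NormedAddCommGroup (Ces p) :=
  AddGroupNorm.toNormedAddCommGroup
    { toFun := fun x => ‖avg x‖
      map_zero' := by
        have : avg (0 : Ces p) = 0 := Subtype.ext absAvg_zero
        rw [this, norm_zero]
      add_le' := by
        intro x y
        have hp : p ≠ 0 := (zero_lt_one.trans_le (Fact.out : 1 ≤ p)).ne'
        refine le_trans (lp.norm_mono hp fun n => ?_) (norm_add_le (avg x) (avg y))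
        change ‖absAvg (x.toSeq + y.toSeq) n‖ ≤ ‖absAvg x.toSeq n + absAvg y.toSeq n‖
        have h := absAvg_add_le x.toSeq y.toSeq n
        have h0 := absAvg_nonneg (x.toSeq + y.toSeq) n
        rw [Real.norm_of_nonneg h0, Real.norm_of_nonneg (h0.trans h)]
        exact h
      neg' := by
        intro x
        have : avg (-x) = avg x := by
          apply Subtype.ext
          funext n
          change absAvg (-x.toSeq) n = absAvg x.toSeq n
          simp [absAvg]
        rw [this]
      eq_zero_of_map_eq_zero' := by
        intro x hx
        have h := norm_eq_zero.1 hx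
        exact Subtype.ext (eq_zero_of_absAvg x.toSeq (congrArg Subtype.val h)) }

theorem norm_def [Fact (1 ≤ p)] (x : Ces p) : ‖x‖ = ‖avg x‖ := rfl

instance [Fact (1 ≤ p)] : NormedSpace ℂ (Ces p) where
  norm_smul_le := by
    intro c x
    have e : avg (c • x) = ‖c‖ • avg x :=
      Subtype.ext (funext fun n => absAvg_smul c x.toSeq n)
    rw [norm_def, norm_def, e]
    exact (norm_smul_le _ _).trans (by rw [norm_norm])

/-- For finite `p` the norm is given by the usual formula. -/
theorem norm_eq_tsum [Fact (1 ≤ p)] (hp : p ≠ ∞) (x : Ces p) :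
    ‖x‖ = (∑' n : ℕ, ((1 / ((n : ℝ) + 1)) * ∑ k ∈ Finset.range (n + 1), ‖x.toSeq k‖) ^ p.toReal)
      ^ (1 / p.toReal) := by
  have h0 : 0 < p.toReal :=
    ENNReal.toReal_pos (zero_lt_one.trans_le (Fact.out : 1 ≤ p)).ne' hp
  rw [norm_def, lp.norm_eq_tsum_rpow h0]
  congr 2
  funext n
  change ‖absAvg x.toSeq n‖ ^ p.toReal = _
  rw [Real.norm_of_nonneg (absAvg_nonneg _ n), absAvg, one_div_mul_eq_div]

/-- For `p = ∞` the norm is the supremum of the averages. -/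
theorem norm_eq_iSup (x : Ces ∞) :
    ‖x‖ = ⨆ n : ℕ, (1 / ((n : ℝ) + 1)) * ∑ k ∈ Finset.range (n + 1), ‖x.toSeq k‖ := by
  rw [norm_def, lp.norm_eq_ciSup]
  congr 1
  funext n
  change ‖absAvg x.toSeq n‖ = _
  rw [Real.norm_of_nonneg (absAvg_nonneg _ n), absAvg, one_div_mul_eq_div]

end Ces

/-! ### The space `ces_0` -/

/-- The sequences whose averages of moduli tend to `0`. -/
def cesZeroSubmodule : Submodule ℂ (ℕ → ℂ) where
  carrier := {x | Tendsto (absAvg x) atTop (𝓝 0)}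
  zero_mem' := by
    change Tendsto (absAvg 0) atTop (𝓝 0)
    rw [absAvg_zero]
    exact tendsto_const_nhds
  add_mem' := by
    intro x y hx hy
    have h : Tendsto (fun n => absAvg x n + absAvg y n) atTop (𝓝 0) := by
      simpa using Tendsto.add hx hy
    exact squeeze_zero (absAvg_nonneg _) (absAvg_add_le x y) h
  smul_mem' := by
    intro c x hx
    have e : absAvg (c • x) = fun n => ‖c‖ * absAvg x n := funext fun n => absAvg_smul c x n
    change Tendsto (absAvg (c • x)) atTop (𝓝 0)
    rw [e]
    simpa using Tendsto.const_mul ‖c‖ hx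

/-- The Cesàro space `ces_0`. -/
def CesZero : Type := cesZeroSubmodule

theorem cesZeroSubmodule_le : cesZeroSubmodule ≤ cesSubmodule ∞ := by
  intro x hx
  have h : Tendsto (fun n => ‖absAvg x n‖) atTop (𝓝 0) := by
    simpa using (show Tendsto (absAvg x) atTop (𝓝 0) from hx).norm
  exact memℓp_infty h.bddAbove_range

namespace CesZero

instance : AddCommGroup CesZero := inferInstanceAs (AddCommGroup cesZeroSubmodule)

instance : Module ℂ CesZero := inferInstanceAs (Module ℂ cesZeroSubmodule)

/-- The sequence underlying an element of `ces_0`. -/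
def toSeq (x : CesZero) : ℕ → ℂ := x.1

/-- The inclusion of `ces_0` in `ces_∞`. -/
def toCesTop : CesZero →ₗ[ℂ] Ces ∞ where
  toFun x := ⟨x.1, cesZeroSubmodule_le x.2⟩
  map_add' _ _ := rfl
  map_smul' _ _ := rfl

theorem toCesTop_injective : Function.Injective toCesTop := fun _ _ h =>
  Subtype.ext (congrArg (fun z : Ces ∞ => z.toSeq) h)

/-- `ces_0` carries the norm of `ces_∞`. -/
instance : NormedAddCommGroup CesZero :=
  NormedAddCommGroup.induced CesZero (Ces ∞) toCesTop toCesTop_injective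

instance : NormedSpace ℂ CesZero := NormedSpace.induced ℂ CesZero (Ces ∞) toCesTop

theorem norm_eq_iSup (x : CesZero) :
    ‖x‖ = ⨆ n : ℕ, (1 / ((n : ℝ) + 1)) * ∑ k ∈ Finset.range (n + 1), ‖x.toSeq k‖ :=
  Ces.norm_eq_iSup (toCesTop x)

end CesZero

/-! ### The generalized Cesàro operators -/

/-- `(C_t x)_n = (t^n x_0 + t^{n-1} x_1 + ⋯ + x_n) / (n+1)` on all complex sequences. -/
def genCesaro (t : ℝ) (x : ℕ → ℂ) (n : ℕ) : ℂ :=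
  (∑ k ∈ Finset.range (n + 1), (t : ℂ) ^ (n - k) * x k) / ((n : ℂ) + 1)

/-- `Λ = {1/(n+1) : n ≥ 0}`. -/
def Lam : Set ℂ := Set.range fun n : ℕ => 1 / ((n : ℂ) + 1)

/-- `Λ₀ = Λ ∪ {0}`. -/
def LamZero : Set ℂ := Lam ∪ {0}

/-! ### Operator-theoretic notions -/

section Operators

variable {X : Type*} [NormedAddCommGroup X] [NormedSpace ℂ X]

/-- The point spectrum: the `μ` for which `μ I - T` is not injective. -/
def pointSpectrum (T : X →L[ℂ] X) : Set ℂ :=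
  {μ | ¬ Function.Injective fun x : X => μ • x - T x}

/-- Boundedness of the operator norms of the powers. -/
def PowerBounded (T : X →L[ℂ] X) : Prop :=
  ∃ M : ℝ, ∀ n : ℕ, ‖T ^ n‖ ≤ M

/-- The Cesàro means `T_{[n]} = (1/n) ∑_{m=1}^n T^m` (for `n ≥ 1`). -/
def cesaroMean (T : X →L[ℂ] X) (n : ℕ) : X →L[ℂ] X :=
  (n : ℂ)⁻¹ • ∑ m ∈ Finset.Icc 1 n, T ^ m

/-- Convergence of the Cesàro means in operator norm. -/
def UniformlyMeanErgodic (T : X →L[ℂ] X) : Prop :=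
  ∃ P : X →L[ℂ] X, Tendsto (cesaroMean T) atTop (𝓝 P)

/-- Existence of a vector with dense projective orbit `{c Tⁿ x : c ∈ ℂ, n ≥ 0}`. -/
def Supercyclic (T : X →L[ℂ] X) : Prop :=
  ∃ x : X, Dense {y : X | ∃ (c : ℂ) (n : ℕ), y = c • (T ^ n) x}

end Operators

end CesaroSeq

end

namespace CesaroSeq

/-! ### Estimates for averages of moduli -/

/-! The three spaces share two features, recorded in `IsCesaroSolid`: the norm is monotone in the
averages of moduli, and `ℓ¹` is contained in the space. Everything but the sharp norm bounds follows
from these and completeness.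

Write `C_t = D S` with `D` multiplication by `1/(n+1)` and `S` convolution with `(t^k)`. `S` is
bounded by `(1-t)⁻¹`, and `D` is a norm limit of finite-rank truncations, so `C_t` is compact. As
`C_t` is lower triangular, the first nonzero entry of an eigenvector determines its eigenvalue;
conversely the sequences `binom(n,m) t^(n-m)` are eigenvectors in `ℓ¹`. Riesz theory then gives the
spectrum.

The eigenvalue `1` splits off through the rank-one projection `P x = x_0 (t^n)_n`: `C_t - P` has
spectral radius below `1`, so `C_t^n → P` in norm, which gives power boundedness and mean ergodicity
(`exists_tendsto_pow`). Supercyclicity fails because `x_0` and `x_1 - t x_0` are eigenfunctionals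
for `1` and `1/2`.

For the remaining norm bounds, `|(C_t x)_n| ≤ A_n(x)`: this gives contractivity in the sup case and,
with `hardy_inequality`, the constant `p/(p-1)`. The eigenvalue `1` makes the sup-case norm exactly
`1`. -/

theorem absAvg_le_mul_of_sum_le {x y : ℕ → ℂ} {c : ℝ} {n : ℕ}
    (h : ∑ k ∈ Finset.range (n + 1), ‖y k‖ ≤ c * ∑ k ∈ Finset.range (n + 1), ‖x k‖) :
    absAvg y n ≤ c * absAvg x n := by
  unfold absAvg
  rw [← mul_div_assoc]
  gcongr

theorem absAvg_le_mul_of_norm_le {x y : ℕ → ℂ} {c : ℝ} (h : ∀ n, ‖y n‖ ≤ c * ‖x n‖) (n : ℕ) :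
    absAvg y n ≤ c * absAvg x n := by
  apply absAvg_le_mul_of_sum_le
  rw [Finset.mul_sum]
  exact Finset.sum_le_sum fun k _ => h k

/-- The operator `x ↦ (∑_{k ≤ n} t^{n-k} x_k)_n`. -/
def geomSum (t : ℝ) : (ℕ → ℂ) →ₗ[ℂ] (ℕ → ℂ) where
  toFun x n := ∑ k ∈ Finset.range (n + 1), (t : ℂ) ^ (n - k) * x k
  map_add' x y := by
    funext n
    simp [mul_add, Finset.sum_add_distrib]
  map_smul' c x := by
    funext n
    simp [Finset.mul_sum, mul_left_comm]

theorem geomSum_apply (t : ℝ) (x : ℕ → ℂ) (n : ℕ) :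
    geomSum t x n = ∑ k ∈ Finset.range (n + 1), (t : ℂ) ^ (n - k) * x k := rfl

theorem geomSum_succ (t : ℝ) (x : ℕ → ℂ) (n : ℕ) :
    geomSum t x (n + 1) = t * geomSum t x n + x (n + 1) := by
  rw [geomSum_apply, geomSum_apply, Finset.sum_range_succ, Finset.mul_sum]
  simp only [Nat.sub_self, pow_zero, one_mul]
  congr 1
  refine Finset.sum_congr rfl fun k hk => ?_
  rw [Nat.succ_sub (Nat.lt_succ_iff.1 (Finset.mem_range.1 hk)), pow_succ]
  ring

/-- Induction on `|s_(n+1)| ≤ t |s_n| + |x_(n+1)|`; the boundary term `t |s_n|` is what makes it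
close. -/
theorem sum_norm_geomSum_le {t : ℝ} (ht0 : 0 ≤ t) (x : ℕ → ℂ) (n : ℕ) :
    (1 - t) * ∑ k ∈ Finset.range (n + 1), ‖geomSum t x k‖ + t * ‖geomSum t x n‖
      ≤ ∑ k ∈ Finset.range (n + 1), ‖x k‖ := by
  induction n with
  | zero => simp [geomSum_apply]; linarith
  | succ n ih =>
    rw [Finset.sum_range_succ, Finset.sum_range_succ _ (n + 1)]
    have h : ‖geomSum t x (n + 1)‖ ≤ t * ‖geomSum t x n‖ + ‖x (n + 1)‖ := by
      rw [geomSum_succ]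
      refine (norm_add_le _ _).trans ?_
      rw [norm_mul, Complex.norm_real, Real.norm_of_nonneg ht0]
    linarith

theorem absAvg_geomSum_le {t : ℝ} (ht0 : 0 ≤ t) (ht1 : t < 1) (x : ℕ → ℂ) (n : ℕ) :
    absAvg (geomSum t x) n ≤ (1 - t)⁻¹ * absAvg x n := by
  apply absAvg_le_mul_of_sum_le
  rw [inv_mul_eq_div, le_div_iff₀ (by linarith), mul_comm]
  have := sum_norm_geomSum_le ht0 x n
  have : 0 ≤ t * ‖geomSum t x n‖ := by positivity
  linarith

/-- The sequence `1/(n+1)`. -/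
noncomputable def harm (n : ℕ) : ℂ := 1 / ((n : ℂ) + 1)

theorem norm_harm (n : ℕ) : ‖harm n‖ = 1 / ((n : ℝ) + 1) := by
  unfold harm
  rw [norm_div, norm_one, ← Nat.cast_succ, Complex.norm_natCast, Nat.cast_succ]

theorem norm_harm_le_one (n : ℕ) : ‖harm n‖ ≤ 1 := by
  rw [norm_harm, div_le_one (by positivity)]
  linarith [(Nat.cast_nonneg n : (0 : ℝ) ≤ n)]

theorem tendsto_harm : Tendsto harm atTop (𝓝 0) := by
  rw [tendsto_zero_iff_norm_tendsto_zero]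
  simp only [norm_harm]
  exact tendsto_one_div_add_atTop_nhds_zero_nat

/-! ### Factorization and eigenvectors of the operator -/

theorem genCesaro_eq (t : ℝ) (x : ℕ → ℂ) : genCesaro t x = harm * geomSum t x := by
  funext n
  simp [genCesaro, geomSum_apply, harm, div_eq_mul_inv, mul_comm]

theorem genCesaro_apply (t : ℝ) (x : ℕ → ℂ) (n : ℕ) :
    genCesaro t x n = harm n * geomSum t x n := congrFun (genCesaro_eq t x) n

/-- The eigenvector of `C_t` with eigenvalue `1/(m+1)`. -/
noncomputable def eigSeq (t : ℝ) (m n : ℕ) : ℂ := (n.choose m : ℂ) * (t : ℂ) ^ (n - m)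

/-- Pascal's rule along the recursion `geomSum_succ`. Truncation of `n - m` is harmless, since the
binomial coefficients vanish where it occurs. -/
theorem geomSum_eigSeq (t : ℝ) (m n : ℕ) :
    geomSum t (eigSeq t m) n = ((n + 1).choose (m + 1) : ℂ) * (t : ℂ) ^ (n - m) := by
  induction n with
  | zero =>
    rcases m with _ | m
    · simp [geomSum_apply, eigSeq]
    · simp [geomSum_apply, eigSeq, Nat.choose_eq_zero_of_lt (by omega : 1 < m + 1 + 1)]
  | succ n ih =>
    rw [geomSum_succ, ih, eigSeq, Nat.choose_succ_succ (n + 1) m]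
    rcases le_or_gt m n with h | h
    · rw [Nat.succ_sub h, pow_succ]
      push_cast
      ring
    · rw [Nat.choose_eq_zero_of_lt (by omega : n + 1 < m + 1)]
      simp

theorem genCesaro_eigSeq (t : ℝ) (m : ℕ) : genCesaro t (eigSeq t m) = harm m • eigSeq t m := by
  funext n
  rw [genCesaro_apply, geomSum_eigSeq, Pi.smul_apply, eigSeq, smul_eq_mul, harm, harm]
  have h : ((n : ℂ) + 1) * (n.choose m) = ((n + 1).choose (m + 1)) * ((m : ℂ) + 1) := by
    exact_mod_cast Nat.add_one_mul_choose_eq n m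
  have h1 : (n : ℂ) + 1 ≠ 0 := Nat.cast_add_one_ne_zero n
  have h2 : (m : ℂ) + 1 ≠ 0 := Nat.cast_add_one_ne_zero m
  field_simp
  linear_combination (-(t : ℂ) ^ (n - m)) * h

theorem eigSeq_self (t : ℝ) (m : ℕ) : eigSeq t m m = 1 := by simp [eigSeq]

theorem summable_norm_eigSeq {t : ℝ} (ht0 : 0 ≤ t) (ht1 : t < 1) (m : ℕ) :
    Summable fun n => ‖eigSeq t m n‖ := by
  rw [← summable_nat_add_iff m]
  have h := summable_choose_mul_geometric_of_norm_lt_one (R := ℝ) m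
    (r := t) (by rwa [Real.norm_of_nonneg ht0])
  refine h.congr fun n => ?_
  simp [eigSeq, abs_of_nonneg ht0]

theorem geomSum_of_forall_lt {t : ℝ} {x : ℕ → ℂ} {m : ℕ} (h : ∀ k < m, x k = 0) :
    geomSum t x m = x m := by
  rw [geomSum_apply, Finset.sum_range_succ, Finset.sum_eq_zero]
  · simp
  · intro k hk
    rw [h k (Finset.mem_range.1 hk), mul_zero]

/-- The first nonzero entry of an eigenvector determines the eigenvalue. -/
theorem exists_eq_harm {t : ℝ} {x : ℕ → ℂ} {μ : ℂ} (hx : x ≠ 0) (h : genCesaro t x = μ • x) :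
    ∃ m, x m ≠ 0 ∧ (∀ k < m, x k = 0) ∧ μ = harm m := by
  classical
  have hex : ∃ m, x m ≠ 0 := Function.ne_iff.1 hx
  refine ⟨Nat.find hex, Nat.find_spec hex, fun k hk => not_not.1 (Nat.find_min hex hk), ?_⟩
  have h1 := congrFun h (Nat.find hex)
  rw [genCesaro_apply, geomSum_of_forall_lt fun k hk => not_not.1 (Nat.find_min hex hk)] at h1
  exact (mul_right_cancel₀ (Nat.find_spec hex) h1).symm

/-! ### General facts about operators -/

section Operators

variable {X : Type*} [NormedAddCommGroup X] [NormedSpace ℂ X]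

theorem isCompactOperator_smulRight (φ : X →L[ℂ] ℂ) (v : X) :
    IsCompactOperator (φ.smulRight v) := by
  have h : IsCompactOperator (φ : X → ℂ) :=
    isCompactOperator_of_locallyCompactSpace_dom φ
  exact h.clm_comp (ContinuousLinearMap.toSpanSingleton ℂ v)

theorem tendsto_pow_zero_of_spectrum [CompleteSpace X] [Nontrivial X] {S : X →L[ℂ] X}
    (h : ∀ μ ∈ spectrum ℂ S, ‖μ‖ < 1) : Tendsto (fun n => S ^ n) atTop (𝓝 0) := by
  have h1 : spectralRadius ℂ S < (1 : NNReal) :=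
    spectrum.spectralRadius_lt_of_forall_lt S fun k hk => by exact_mod_cast h k hk
  obtain ⟨r, hr, hr1⟩ := ENNReal.lt_iff_exists_nnreal_btwn.1 h1
  have hr1' : r < 1 := by exact_mod_cast hr1
  -- Gelfand's formula: eventually the powers decay at least like `r^n`.
  have h2 := (spectrum.pow_nnnorm_pow_one_div_tendsto_nhds_spectralRadius S).eventually_lt_const hr
  have h3 : ∀ᶠ n : ℕ in atTop, ‖S ^ n‖ ≤ (r : ℝ) ^ n := by
    filter_upwards [h2, eventually_ge_atTop 1] with n hn hn1
    have hn0 : (0 : ℝ) < n := by exact_mod_cast hn1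
    have h4 := ENNReal.rpow_le_rpow hn.le hn0.le
    rw [← ENNReal.rpow_mul, one_div, inv_mul_cancel₀ hn0.ne', ENNReal.rpow_one,
      ENNReal.rpow_natCast] at h4
    exact_mod_cast h4
  exact squeeze_zero_norm' h3 (tendsto_pow_atTop_nhds_zero_of_lt_one r.2 (by exact_mod_cast hr1'))

theorem powerBounded_of_tendsto {T P : X →L[ℂ] X} (h : Tendsto (fun n => T ^ n) atTop (𝓝 P)) :
    PowerBounded T := by
  obtain ⟨M, hM⟩ := h.norm.bddAbove_range
  exact ⟨M, fun n => hM ⟨n, rfl⟩⟩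

theorem uniformlyMeanErgodic_of_tendsto {T P : X →L[ℂ] X}
    (h : Tendsto (fun n => T ^ n) atTop (𝓝 P)) : UniformlyMeanErgodic T := by
  refine ⟨P, ?_⟩
  -- The shift by one matches means over `1, …, n` rather than `0, …, n-1`.
  have h1 := ((tendsto_add_atTop_iff_nat 1).2 h).cesaro_smul
  refine h1.congr fun n => ?_
  rw [cesaroMean, Finset.range_eq_Ico, Finset.sum_Ico_add' (fun m => T ^ m) 0 n 1, zero_add,
    ← Complex.coe_smul]
  push_cast
  rfl

theorem mem_pointSpectrum_iff {T : X →L[ℂ] X} {μ : ℂ} :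
    μ ∈ pointSpectrum T ↔ ∃ x, x ≠ 0 ∧ T x = μ • x := by
  have e : (fun x : X => μ • x - T x) = (μ • ContinuousLinearMap.id ℂ X - T : X →L[ℂ] X) := rfl
  rw [pointSpectrum, Set.mem_ofPred_eq, e, injective_iff_map_eq_zero]
  push Not
  refine exists_congr fun x => ?_
  rw [and_comm, and_congr_right_iff]
  intro _
  change μ • x - T x = 0 ↔ _
  rw [sub_eq_zero, eq_comm]

theorem one_le_norm_of_mem_pointSpectrum {T : X →L[ℂ] X} (h : (1 : ℂ) ∈ pointSpectrum T) :
    1 ≤ ‖T‖ := by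
  obtain ⟨x, hx, h1⟩ := mem_pointSpectrum_iff.1 h
  have h2 := T.le_opNorm x
  rw [h1, one_smul] at h2
  exact le_of_mul_le_mul_right (by simpa using h2) (norm_pos_iff.2 hx)

theorem mem_pointSpectrum_of_mem_spectrum [CompleteSpace X] {T : X →L[ℂ] X}
    (hT : IsCompactOperator T) {μ : ℂ} (hμ : μ ≠ 0) (h : μ ∈ spectrum ℂ T) :
    μ ∈ pointSpectrum T := by
  have h1 := (hT.hasEigenvalue_iff_mem_spectrum hμ).2 h
  obtain ⟨x, hx⟩ := h1.exists_hasEigenvector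
  exact mem_pointSpectrum_iff.2 ⟨x, hx.2, hx.apply_eq_smul⟩

theorem pointSpectrum_subset_spectrum (T : X →L[ℂ] X) : pointSpectrum T ⊆ spectrum ℂ T := by
  intro μ hμ h
  obtain ⟨x, hx, hTx⟩ := mem_pointSpectrum_iff.1 hμ
  obtain ⟨u, hu⟩ := h
  have h1 : (algebraMap ℂ (X →L[ℂ] X) μ - T) x = 0 := by
    simp [Algebra.algebraMap_eq_smul_one, hTx]
  have h2 : ((↑u⁻¹ * ↑u : X →L[ℂ] X)) x = 0 := by
    rw [hu, mul_apply_eq_comp, h1, map_zero]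
  rw [Units.inv_mul] at h2
  exact hx h2

/-- An operator whose adjoint has two linearly independent eigenvectors, with eigenvalues `1` and
`b`, is not supercyclic. -/
theorem not_supercyclic {T : X →L[ℂ] X} {φ ψ : X →L[ℂ] ℂ} {b : ℂ} (hb : ‖b‖ ≤ 1)
    (hφ : ∀ x, φ (T x) = φ x) (hψ : ∀ x, ψ (T x) = b * ψ x)
    {u v : X} (hu : φ u ≠ 0) (hv : φ v = 0) (hv' : ψ v ≠ 0) : ¬ Supercyclic T := by
  rintro ⟨x, hx⟩
  have h1 : ∀ n, φ ((T ^ n) x) = φ x := by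
    intro n
    induction n with
    | zero => simp
    | succ n ih => rw [pow_succ', mul_apply_eq_comp, hφ, ih]
  have h2 : ∀ n, ‖ψ ((T ^ n) x)‖ ≤ ‖ψ x‖ := by
    intro n
    induction n with
    | zero => simp
    | succ n ih =>
      rw [pow_succ', mul_apply_eq_comp, hψ, norm_mul]
      exact (mul_le_of_le_one_left (norm_nonneg _) hb).trans ih
  -- If `φ x = 0` the projective orbit stays in the hyperplane `ker φ`, which misses `u`.
  by_cases h0 : φ x = 0
  · have hc : IsClosed {y | φ y = 0} := isClosed_eq φ.continuous continuous_const
    have := closure_minimal (s := {y : X | ∃ (c : ℂ) (n : ℕ), y = c • (T ^ n) x}) (by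
      rintro _ ⟨c, n, rfl⟩
      rw [Set.mem_ofPred_eq, map_smul, h1, h0, smul_zero]) hc
    rw [hx.closure_eq] at this
    exact hu (this (Set.mem_univ u))
  -- Otherwise it stays in this closed cone, since `φ` is constant and `|ψ|` does not grow along the
  -- orbit; `v` lies outside the cone.
  · have hc : IsClosed {y | ‖φ x‖ * ‖ψ y‖ ≤ ‖ψ x‖ * ‖φ y‖} :=
      isClosed_le (by fun_prop) (by fun_prop)
    have := closure_minimal (s := {y : X | ∃ (c : ℂ) (n : ℕ), y = c • (T ^ n) x}) (by
      rintro _ ⟨c, n, rfl⟩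
      simp only [Set.mem_ofPred_eq, map_smul, smul_eq_mul, norm_mul, h1]
      have := mul_le_mul_of_nonneg_left (h2 n) (by positivity : 0 ≤ ‖φ x‖ * ‖c‖)
      linarith) hc
    rw [hx.closure_eq] at this
    have h3 : ‖φ x‖ * ‖ψ v‖ ≤ ‖ψ x‖ * ‖φ v‖ := this (Set.mem_univ v)
    rw [hv, norm_zero, mul_zero] at h3
    have : 0 < ‖φ x‖ * ‖ψ v‖ := by positivity
    linarith

end Operators

/-! ### Solid spaces of sequences -/

section Solid

variable {X : Type*} [NormedAddCommGroup X] [NormedSpace ℂ X]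

/-- `J` realizes `X` as a space of sequences which contains `ℓ¹` and whose norm is a monotone
function of the averages of moduli. -/
structure IsCesaroSolid (J : X →ₗ[ℂ] (ℕ → ℂ)) : Prop where
  injective : Function.Injective J
  solid : ∀ (x : X) (y : ℕ → ℂ) (c : ℝ), 0 ≤ c → (∀ n, absAvg y n ≤ c * absAvg (J x) n) →
    ∃ z, J z = y ∧ ‖z‖ ≤ c * ‖x‖
  summable : ∀ y : ℕ → ℂ, (Summable fun n => ‖y n‖) → ∃ z, J z = y

namespace IsCesaroSolid

variable {J : X →ₗ[ℂ] (ℕ → ℂ)} (hJ : IsCesaroSolid J)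
include hJ

theorem norm_le {x y : X} {c : ℝ} (hc : 0 ≤ c) (h : ∀ n, absAvg (J y) n ≤ c * absAvg (J x) n) :
    ‖y‖ ≤ c * ‖x‖ := by
  obtain ⟨z, hz, hzx⟩ := hJ.solid x (J y) c hc h
  rwa [hJ.injective hz] at hzx

theorem exists_clm (L : (ℕ → ℂ) →ₗ[ℂ] (ℕ → ℂ)) {c : ℝ} (hc : 0 ≤ c)
    (h : ∀ x n, absAvg (L x) n ≤ c * absAvg x n) :
    ∃ T : X →L[ℂ] X, (∀ x, J (T x) = L (J x)) ∧ ‖T‖ ≤ c := by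
  choose f hf hfc using fun x => hJ.solid x (L (J x)) c hc (h (J x))
  refine ⟨LinearMap.mkContinuous
    { toFun := f
      map_add' := fun x y => hJ.injective (by simp only [map_add, hf])
      map_smul' := fun a x => hJ.injective (by simp only [map_smul, hf, RingHom.id_apply]) }
    c hfc, hf, LinearMap.mkContinuous_norm_le _ hc _⟩

theorem exists_mulLeft (d : ℕ → ℂ) {c : ℝ} (hc : 0 ≤ c) (h : ∀ n, ‖d n‖ ≤ c) :
    ∃ T : X →L[ℂ] X, (∀ x, J (T x) = d * J x) ∧ ‖T‖ ≤ c :=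
  hJ.exists_clm (LinearMap.mulLeft ℂ d) hc fun x => absAvg_le_mul_of_norm_le fun n => by
    simp only [LinearMap.mulLeft_apply, Pi.mul_apply, norm_mul]
    gcongr
    exact h n

theorem exists_single (k : ℕ) : ∃ e : X, J e = Pi.single k 1 := by
  refine hJ.summable _ (summable_of_ne_finset_zero (s := {k}) fun n hn => ?_)
  rw [Pi.single_eq_of_ne (by simpa using hn), norm_zero]

/-- The sequence `x_k e_k` is dominated by `x` entrywise, so solidity yields `|x_k| ‖e_k‖ ≤ ‖x‖`. -/
theorem exists_coord (k : ℕ) : ∃ φ : X →L[ℂ] ℂ, ∀ x, φ x = J x k := by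
  obtain ⟨e, he⟩ := hJ.exists_single k
  have he0 : 0 < ‖e‖ := norm_pos_iff.2 fun h => by
    have := congrFun he k
    simp [h] at this
  refine ⟨LinearMap.mkContinuous ((LinearMap.proj k).comp J) ‖e‖⁻¹ fun x => ?_, fun x => rfl⟩
  have h1 : ‖J x k • e‖ ≤ 1 * ‖x‖ := hJ.norm_le zero_le_one <|
    absAvg_le_mul_of_norm_le fun n => by
      rw [map_smul, he, one_mul, Pi.smul_apply]
      rcases eq_or_ne n k with rfl | h
      · simp
      · simp [h]
  rw [norm_smul, one_mul] at h1
  rw [inv_mul_eq_div, le_div_iff₀ he0]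
  exact h1

/-- Truncating `d` after `N` entries gives a finite-rank operator, and by solidity the error is at
most `sup_{n ≥ N} |d n|`. -/
theorem isCompactOperator_mul [CompleteSpace X] {d : ℕ → ℂ} (hd : Tendsto d atTop (𝓝 0))
    {D : X →L[ℂ] X} (hD : ∀ x, J (D x) = d * J x) : IsCompactOperator D := by
  choose e he using hJ.exists_single
  choose φ hφ using hJ.exists_coord
  set F : ℕ → X →L[ℂ] X := fun N => ∑ k ∈ Finset.range N, d k • (φ k).smulRight (e k) with hF
  have hJF : ∀ N x n, J (F N x) n = if n < N then d n * J x n else 0 := by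
    intro N x n
    simp only [hF, sum_apply, map_sum, smul_apply,
      map_smul, ContinuousLinearMap.smulRight_apply, he, hφ, Finset.sum_apply, Pi.smul_apply,
      smul_eq_mul, Pi.single_apply, mul_ite, mul_one, mul_zero]
    simp
  have hlim : Tendsto F atTop (𝓝 D) := by
    rw [tendsto_iff_norm_sub_tendsto_zero, Metric.tendsto_atTop]
    intro ε hε
    obtain ⟨N, hN⟩ := Metric.tendsto_atTop.1 hd (ε / 2) (half_pos hε)
    refine ⟨N, fun M hM => ?_⟩
    have h1 : ‖F M - D‖ ≤ ε / 2 :=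
      ContinuousLinearMap.opNorm_le_bound _ (half_pos hε).le fun x =>
        hJ.norm_le (half_pos hε).le <| absAvg_le_mul_of_norm_le fun n => by
          rw [sub_apply, map_sub, Pi.sub_apply, hJF, hD, Pi.mul_apply]
          split_ifs with h
          · simp only [sub_self, norm_zero]
            positivity
          · rw [zero_sub, norm_neg, norm_mul]
            gcongr
            have := hN n (by omega)
            rw [dist_zero_right] at this
            exact this.le
    rw [dist_zero_right, norm_norm]
    linarith
  refine isCompactOperator_of_tendsto hlim (Eventually.of_forall fun N => ?_)
  exact (compactOperator (RingHom.id ℂ) X X).sum_mem (t := Finset.range N)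
    (f := fun k => d k • (φ k).smulRight (e k))
    fun k _ => (isCompactOperator_smulRight (φ k) (e k)).smul (d k)

/-! ### Spectrum and dynamics on a solid space -/

variable {t : ℝ}

theorem exists_genCesaro [CompleteSpace X] (ht0 : 0 ≤ t) (ht1 : t < 1) :
    ∃ T : X →L[ℂ] X, (∀ x, J (T x) = genCesaro t (J x)) ∧ ‖T‖ ≤ (1 - t)⁻¹ ∧
      IsCompactOperator T := by
  have h0 : 0 ≤ (1 - t)⁻¹ := inv_nonneg.2 (by linarith)
  obtain ⟨D, hD, hD1⟩ := hJ.exists_mulLeft harm zero_le_one norm_harm_le_one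
  obtain ⟨S, hS, hS1⟩ := hJ.exists_clm (geomSum t) h0 (absAvg_geomSum_le ht0 ht1)
  refine ⟨D * S, fun x => ?_, ?_, ?_⟩
  · rw [mul_apply_eq_comp, hD, hS, genCesaro_eq]
  · refine (norm_mul_le _ _).trans ?_
    simpa using mul_le_mul hD1 hS1 (norm_nonneg S) zero_le_one
  · exact (hJ.isCompactOperator_mul tendsto_harm hD).comp_clm S

theorem exists_eigvec (ht0 : 0 ≤ t) (ht1 : t < 1) {T : X →L[ℂ] X}
    (hT : ∀ x, J (T x) = genCesaro t (J x)) (m : ℕ) :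
    ∃ x, J x = eigSeq t m ∧ T x = harm m • x := by
  obtain ⟨x, hx⟩ := hJ.summable _ (summable_norm_eigSeq ht0 ht1 m)
  exact ⟨x, hx, hJ.injective (by rw [hT, hx, genCesaro_eigSeq, map_smul, hx])⟩

theorem exists_eq_harm {T : X →L[ℂ] X} (hT : ∀ x, J (T x) = genCesaro t (J x)) {x : X} {μ : ℂ}
    (hx : x ≠ 0) (h : T x = μ • x) :
    ∃ m, J x m ≠ 0 ∧ (∀ k < m, J x k = 0) ∧ μ = harm m := by
  refine CesaroSeq.exists_eq_harm (t := t) (fun h0 => hx (hJ.injective ?_)) ?_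
  · rw [h0, map_zero]
  · rw [← hT, h, map_smul]

theorem pointSpectrum_eq (ht0 : 0 ≤ t) (ht1 : t < 1) {T : X →L[ℂ] X}
    (hT : ∀ x, J (T x) = genCesaro t (J x)) : pointSpectrum T = Lam := by
  ext μ
  rw [mem_pointSpectrum_iff]
  constructor
  · rintro ⟨x, hx, h⟩
    obtain ⟨m, -, -, hm⟩ := hJ.exists_eq_harm hT hx h
    exact ⟨m, hm.symm⟩
  · rintro ⟨m, rfl⟩
    obtain ⟨x, hx, h⟩ := hJ.exists_eigvec ht0 ht1 hT m
    refine ⟨x, ?_, h⟩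
    rintro rfl
    have := congrFun hx m
    simp [eigSeq_self] at this

theorem spectrum_eq [CompleteSpace X] (ht0 : 0 ≤ t) (ht1 : t < 1) {T : X →L[ℂ] X}
    (hT : ∀ x, J (T x) = genCesaro t (J x)) (hc : IsCompactOperator T) :
    spectrum ℂ T = LamZero := by
  have hp := hJ.pointSpectrum_eq ht0 ht1 hT
  have hsub := hp ▸ pointSpectrum_subset_spectrum T
  apply Set.Subset.antisymm
  · intro μ hμ
    by_cases h0 : μ = 0
    · exact Or.inr h0
    · exact Or.inl (hp ▸ mem_pointSpectrum_of_mem_spectrum hc h0 hμ)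
  · rintro μ (h | h)
    · exact hsub h
    · rw [Set.mem_singleton_iff.1 h]
      -- `0` is the limit of the eigenvalues `1/(n+1)`.
      exact (spectrum.isClosed T).mem_of_tendsto tendsto_harm
        (Eventually.of_forall fun n => hsub ⟨n, rfl⟩)

theorem exists_tendsto_pow [CompleteSpace X] (ht0 : 0 ≤ t) (ht1 : t < 1) {T : X →L[ℂ] X}
    (hT : ∀ x, J (T x) = genCesaro t (J x)) (hc : IsCompactOperator T) :
    ∃ P : X →L[ℂ] X, Tendsto (fun n => T ^ n) atTop (𝓝 P) := by
  obtain ⟨e, he, hTe⟩ := hJ.exists_eigvec ht0 ht1 hT 0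
  have he1 : J e 0 = 1 := by rw [he, eigSeq_self]
  have hTe : T e = e := by simpa [harm] using hTe
  obtain ⟨φ, hφ⟩ := hJ.exists_coord 0
  have hφT : ∀ x, φ (T x) = φ x := fun x => by
    rw [hφ, hφ, hT]
    simp [genCesaro]
  have hφe : φ e = 1 := by rw [hφ, he1]
  have : Nontrivial X := ⟨e, 0, by rintro rfl; simp at hφe⟩
  set P : X →L[ℂ] X := φ.smulRight e with hP
  have hPx : ∀ x, P x = φ x • e := fun x => rfl
  have hTP : T * P = P := by
    ext x
    simp only [mul_apply_eq_comp, hPx, map_smul, hTe]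
  have hPT : P * T = P := by
    ext x
    simp only [mul_apply_eq_comp, hPx, hφT]
  have hPP : P * P = P := by
    ext x
    simp only [mul_apply_eq_comp, hPx, map_smul, hφe, smul_eq_mul, mul_one]
  -- `P` is idempotent and absorbs `T` on both sides, so mixed terms cancel. The exponent starts at
  -- `1`: the identity fails at `0`.
  have hpow : ∀ n, T ^ (n + 1) = P + (T - P) ^ (n + 1) := by
    intro n
    induction n with
    | zero => simp
    | succ n ih =>
      have h1 : P * (T - P) ^ (n + 1) = 0 := by
        rw [pow_succ', ← mul_assoc, mul_sub, hPT, hPP, sub_self, zero_mul]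
      rw [pow_succ', ih, pow_succ' _ (n + 1), mul_add, hTP, sub_mul, h1, sub_zero]
  have hcS : IsCompactOperator (T - P) := hc.sub (isCompactOperator_smulRight φ e)
  refine ⟨P, ?_⟩
  rw [← tendsto_add_atTop_iff_nat 1]
  simp only [hpow]
  have hlim := (tendsto_add_atTop_iff_nat 1).2 (tendsto_pow_zero_of_spectrum (S := T - P) ?_)
  · simpa using hlim.const_add P
  intro μ hμ
  by_cases h0 : μ = 0
  · simp [h0]
  obtain ⟨x, hx, hTx⟩ := mem_pointSpectrum_iff.1 (mem_pointSpectrum_of_mem_spectrum hcS h0 hμ)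
  -- `φ ∘ (T - P) = 0`, so an eigenvector of `T - P` for `μ ≠ 0` lies in `ker φ`, where `P`
  -- vanishes; it is thus an eigenvector of `T`. Its first nonzero index is then positive, which
  -- excludes `μ = 1`.
  have hφx : φ x = 0 := by
    have := congrArg φ hTx
    rw [sub_apply, map_sub, hφT, hPx, map_smul, hφe, smul_eq_mul, mul_one,
      sub_self, map_smul, smul_eq_mul] at this
    exact (mul_eq_zero.1 this.symm).resolve_left h0
  rw [sub_apply, hPx, hφx, zero_smul, sub_zero] at hTx
  obtain ⟨m, hm, -, rfl⟩ := hJ.exists_eq_harm hT hx hTx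
  have hm0 : 0 < m := Nat.pos_of_ne_zero fun h => hm (by rw [h, ← hφ, hφx])
  have hm1 : (0 : ℝ) < m := by exact_mod_cast hm0
  rw [norm_harm, div_lt_one (by positivity)]
  linarith

theorem not_supercyclic {T : X →L[ℂ] X} (hT : ∀ x, J (T x) = genCesaro t (J x)) :
    ¬ Supercyclic T := by
  obtain ⟨φ, hφ⟩ := hJ.exists_coord 0
  obtain ⟨ψ, hψ⟩ := hJ.exists_coord 1
  obtain ⟨u, hu⟩ := hJ.exists_single 0
  obtain ⟨v, hv⟩ := hJ.exists_single 1
  refine CesaroSeq.not_supercyclic (φ := φ) (ψ := ψ - (t : ℂ) • φ) (b := 1 / 2) (u := u) (v := v)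
    (by norm_num) (fun x => ?_) (fun x => ?_) ?_ ?_ ?_
  · rw [hφ, hφ, hT]
    simp [genCesaro]
  · simp [hφ, hψ, hT, genCesaro, Finset.sum_range_succ]
    ring
  · simp [hφ, hu]
  · simp [hφ, hv]
  · simp [hφ, hψ, hv]

theorem genCesaro_properties [CompleteSpace X] (ht0 : 0 ≤ t) (ht1 : t < 1) :
    ∃ T : X →L[ℂ] X, (∀ x, J (T x) = genCesaro t (J x)) ∧ ‖T‖ ≤ (1 - t)⁻¹ ∧ 1 ≤ ‖T‖ ∧
      IsCompactOperator T ∧ pointSpectrum T = Lam ∧ spectrum ℂ T = LamZero ∧ PowerBounded T ∧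
      UniformlyMeanErgodic T ∧ ¬ Supercyclic T := by
  obtain ⟨T, hT, hn, hc⟩ := hJ.exists_genCesaro ht0 ht1
  obtain ⟨P, hP⟩ := hJ.exists_tendsto_pow ht0 ht1 hT hc
  have hp := hJ.pointSpectrum_eq ht0 ht1 hT
  refine ⟨T, hT, hn, one_le_norm_of_mem_pointSpectrum ?_, hc, hp, hJ.spectrum_eq ht0 ht1 hT hc,
    powerBounded_of_tendsto hP, uniformlyMeanErgodic_of_tendsto hP, hJ.not_supercyclic hT⟩
  rw [hp]
  exact ⟨0, by simp⟩

end IsCesaroSolid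

end Solid

/-! ### Hardy's inequality -/

/-- Elliott's telescoping argument for Hardy's inequality: with `a_N = (N+1) A - N B` for
consecutive averages `B`, `A`, Young's inequality bounds `p A^(p-1) B` by `B^p + (p-1) A^p`. The
second term on the left is the telescoped boundary term. -/
theorem sum_rpow_avg_le_sum_mul {p : ℝ} (hp : 1 < p) {a : ℕ → ℝ} (ha : ∀ n, 0 ≤ a n) (N : ℕ) :
    (p - 1) * ∑ n ∈ Finset.range N, ((∑ k ∈ Finset.range (n + 1), a k) / ((n : ℝ) + 1)) ^ p
        + N * ((∑ k ∈ Finset.range N, a k) / N) ^ p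
      ≤ p * ∑ n ∈ Finset.range N,
        ((∑ k ∈ Finset.range (n + 1), a k) / ((n : ℝ) + 1)) ^ (p - 1) * a n := by
  induction N with
  | zero => simp
  | succ N ih =>
    rw [Finset.sum_range_succ (fun n : ℕ => ((∑ k ∈ Finset.range (n + 1), a k) / ((n : ℝ) + 1)) ^ p),
      Finset.sum_range_succ
        (fun n : ℕ => ((∑ k ∈ Finset.range (n + 1), a k) / ((n : ℝ) + 1)) ^ (p - 1) * a n),
      Nat.cast_succ]
    set A := (∑ k ∈ Finset.range (N + 1), a k) / ((N : ℝ) + 1) with hA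
    set B := (∑ k ∈ Finset.range N, a k) / (N : ℝ) with hB
    have hA0 : 0 ≤ A := div_nonneg (Finset.sum_nonneg fun k _ => ha k) (by positivity)
    have hB0 : 0 ≤ B := div_nonneg (Finset.sum_nonneg fun k _ => ha k) (by positivity)
    -- For `N = 0` the average `B` is `0 / 0 = 0`, so no separate base case is needed.
    have hNB : (N : ℝ) * B = ∑ k ∈ Finset.range N, a k := by
      rcases Nat.eq_zero_or_pos N with rfl | h
      · simp
      · rw [hB]; field_simp
    have haN : a N = ((N : ℝ) + 1) * A - N * B := by
      rw [hNB, hA, Finset.sum_range_succ]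
      field_simp
      ring
    have hAp : A ^ (p - 1) * A = A ^ p := by
      conv_lhs => rw [← Real.rpow_one A, ← Real.rpow_mul hA0, one_mul]
      rw [← Real.rpow_add_of_nonneg hA0 (by linarith) zero_le_one, sub_add_cancel]
    have hpq : p.HolderConjugate p.conjExponent := Real.HolderConjugate.conjExponent hp
    have hy := Real.young_inequality_of_nonneg hB0 (Real.rpow_nonneg hA0 (p - 1)) hpq
    rw [← Real.rpow_mul hA0, hpq.sub_one_mul_conj, Real.conjExponent] at hy
    have hy' : p * (A ^ (p - 1) * B) ≤ B ^ p + (p - 1) * A ^ p := by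
      have h1 := mul_le_mul_of_nonneg_left hy (by linarith : 0 ≤ p)
      have h2 : p * (B ^ p / p + A ^ p / (p / (p - 1))) = B ^ p + (p - 1) * A ^ p := by
        have : p ≠ 0 := by linarith
        have : p - 1 ≠ 0 := by linarith
        field_simp
      rw [h2] at h1
      linarith
    have h3 := mul_le_mul_of_nonneg_left hy' (Nat.cast_nonneg N : (0 : ℝ) ≤ N)
    have h4 : p * (A ^ (p - 1) * a N) = p * (N + 1) * A ^ p - N * (p * (A ^ (p - 1) * B)) := by
      rw [haN, ← hAp]; ring
    rw [mul_add, mul_add, h4]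
    linarith

theorem hardy_inequality {p : ℝ} (hp : 1 < p) {a : ℕ → ℝ} (ha : ∀ n, 0 ≤ a n) (N : ℕ) :
    ∑ n ∈ Finset.range N, ((∑ k ∈ Finset.range (n + 1), a k) / ((n : ℝ) + 1)) ^ p
      ≤ (p / (p - 1)) ^ p * ∑ n ∈ Finset.range N, a n ^ p := by
  set A : ℕ → ℝ := fun n => (∑ k ∈ Finset.range (n + 1), a k) / ((n : ℝ) + 1)
  have hA0 : ∀ n, 0 ≤ A n := fun n =>
    div_nonneg (Finset.sum_nonneg fun k _ => ha k) (by positivity)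
  have hp1 : 0 < p - 1 := by linarith
  have hq0 : 0 ≤ p / (p - 1) := by positivity
  have hpq : p.HolderConjugate p.conjExponent := Real.HolderConjugate.conjExponent hp
  have h1 := sum_rpow_avg_le_sum_mul hp ha N
  have h2 : 0 ≤ (N : ℝ) * ((∑ k ∈ Finset.range N, a k) / N) ^ p :=
    mul_nonneg (Nat.cast_nonneg N) (Real.rpow_nonneg
      (div_nonneg (Finset.sum_nonneg fun k _ => ha k) (Nat.cast_nonneg N)) p)
  -- Young's inequality is applied to `q a_n` and `A_n^(p-1)` with `q = p/(p-1)`. Since `(p-1) q =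
  -- p` and `1/q = 1 - 1/p`, what survives after absorbing the sum of `A_n^p` is `S/p ≤ R/p`.
  have h3 : p * ∑ n ∈ Finset.range N, A n ^ (p - 1) * a n
      ≤ (p - 1) * ∑ n ∈ Finset.range N,
        ((p / (p - 1)) ^ p * a n ^ p / p + A n ^ p / (p / (p - 1))) := by
    rw [Finset.mul_sum, Finset.mul_sum]
    refine Finset.sum_le_sum fun n _ => ?_
    have hy := Real.young_inequality_of_nonneg (mul_nonneg hq0 (ha n))
      (Real.rpow_nonneg (hA0 n) (p - 1)) hpq
    rw [← Real.rpow_mul (hA0 n), hpq.sub_one_mul_conj, Real.conjExponent,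
      Real.mul_rpow hq0 (ha n)] at hy
    refine le_trans (le_of_eq ?_) (mul_le_mul_of_nonneg_left hy hp1.le)
    field_simp
  rw [Finset.sum_add_distrib, ← Finset.sum_div, ← Finset.sum_div, ← Finset.mul_sum] at h3
  set S := ∑ n ∈ Finset.range N, A n ^ p
  set R := (p / (p - 1)) ^ p * ∑ n ∈ Finset.range N, a n ^ p
  have h4 : (p - 1) * S ≤ (p - 1) * (R / p + S / (p / (p - 1))) := by linarith
  have h5 := le_of_mul_le_mul_left h4 hp1
  have h6 : S / (p / (p - 1)) = S - S / p := by field_simp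
  rw [h6] at h5
  exact (div_le_div_iff_of_pos_right (by linarith : 0 < p)).1 (by linarith)

/-! ### Bounds through averages of averages -/

theorem norm_genCesaro_le {t : ℝ} (ht0 : 0 ≤ t) (ht1 : t < 1) (x : ℕ → ℂ) (n : ℕ) :
    ‖genCesaro t x n‖ ≤ absAvg x n := by
  rw [genCesaro_apply, norm_mul, norm_harm, absAvg, one_div_mul_eq_div, geomSum_apply]
  gcongr
  refine norm_sum_le_of_le _ fun k _ => ?_
  rw [norm_mul, norm_pow, Complex.norm_real, Real.norm_of_nonneg ht0]
  exact mul_le_of_le_one_left (norm_nonneg _) (pow_le_one₀ ht0 ht1.le)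

theorem absAvg_genCesaro_le {t : ℝ} (ht0 : 0 ≤ t) (ht1 : t < 1) (x : ℕ → ℂ) (n : ℕ) :
    absAvg (genCesaro t x) n ≤ (∑ k ∈ Finset.range (n + 1), absAvg x k) / ((n : ℝ) + 1) := by
  rw [absAvg]
  gcongr
  exact norm_genCesaro_le ht0 ht1 x _

theorem absAvg_genCesaro_le_of_forall_le {t : ℝ} (ht0 : 0 ≤ t) (ht1 : t < 1) {x : ℕ → ℂ} {c : ℝ}
    (h : ∀ n, absAvg x n ≤ c) (n : ℕ) : absAvg (genCesaro t x) n ≤ c := by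
  refine (absAvg_genCesaro_le ht0 ht1 x n).trans ?_
  rw [div_le_iff₀ (by positivity)]
  refine (Finset.sum_le_card_nsmul _ _ c fun k _ => h k).trans (le_of_eq ?_)
  rw [Finset.card_range, nsmul_eq_mul]
  push_cast
  ring

theorem exists_absAvg_le_of_summable {y : ℕ → ℂ} (hy : Summable fun n => ‖y n‖) :
    ∃ B : ℝ, ∀ n, absAvg y n ≤ B * (1 / ((n : ℝ) + 1)) := by
  refine ⟨∑' n, ‖y n‖, fun n => ?_⟩
  rw [absAvg, mul_one_div]
  gcongr
  exact hy.sum_le_tsum _ fun k _ => norm_nonneg _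

/-! ### The spaces `ces_p` are complete and solid -/

namespace Ces

variable {p : ℝ≥0∞}

theorem avg_apply (x : Ces p) (n : ℕ) : avg x n = absAvg x.toSeq n := rfl

theorem norm_avg_apply (x : Ces p) (n : ℕ) : ‖avg x n‖ = absAvg x.toSeq n := by
  rw [avg_apply, Real.norm_of_nonneg (absAvg_nonneg _ n)]

theorem toSeq_sub (x y : Ces p) : (x - y).toSeq = x.toSeq - y.toSeq := rfl

/-- The sections `(x_0, …, x_n)/(n+1)` of a sequence, in the space `ℂ^{n+1}` with the `ℓ¹`-norm. -/
noncomputable def sec (x : ℕ → ℂ) (n : ℕ) : PiLp 1 (fun _ : Fin (n + 1) => ℂ) :=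
  ((n : ℂ) + 1)⁻¹ • WithLp.toLp 1 fun k : Fin (n + 1) => x k

theorem norm_sec (x : ℕ → ℂ) (n : ℕ) : ‖sec x n‖ = absAvg x n := by
  rw [sec, norm_smul, PiLp.norm_eq_of_L1, norm_inv, ← Nat.cast_succ, Complex.norm_natCast,
    absAvg, inv_mul_eq_div, Nat.cast_succ, Finset.sum_range]

theorem sec_apply (x : ℕ → ℂ) (n : ℕ) (k : Fin (n + 1)) :
    sec x n k = ((n : ℂ) + 1)⁻¹ * x k := rfl

theorem memℓp_sec_iff {x : ℕ → ℂ} : Memℓp (sec x) p ↔ x ∈ cesSubmodule p := by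
  constructor
  · intro h
    exact Memℓp.mono' h fun n => by rw [norm_sec, Real.norm_of_nonneg (absAvg_nonneg _ n)]
  · intro h
    exact Memℓp.mono h fun n => (norm_sec x n).le

/-- The isometric embedding of `ces_p` in an `ℓ^p`-sum of finite-dimensional spaces. -/
noncomputable def secLp (x : Ces p) : lp (fun n : ℕ => PiLp 1 fun _ : Fin (n + 1) => ℂ) p :=
  ⟨sec x.toSeq, memℓp_sec_iff.2 x.2⟩

theorem p_ne_zero (p : ℝ≥0∞) [Fact (1 ≤ p)] : p ≠ 0 :=
  (zero_lt_one.trans_le (Fact.out : 1 ≤ p)).ne'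

variable [Fact (1 ≤ p)]

theorem norm_secLp_sub (x y : Ces p) : ‖secLp x - secLp y‖ = ‖x - y‖ := by
  have h : ∀ n, ‖(secLp x - secLp y) n‖ = ‖avg (x - y) n‖ := by
    intro n
    rw [norm_avg_apply, ← norm_sec]
    change ‖sec x.toSeq n - sec y.toSeq n‖ = _
    congr 1
    ext k
    simp [sec_apply, toSeq_sub, mul_sub]
  rw [norm_def]
  exact le_antisymm (lp.norm_mono (p_ne_zero p) fun n => (h n).le)
    (lp.norm_mono (p_ne_zero p) fun n => (h n).ge)

theorem isometry_secLp : Isometry (secLp (p := p)) :=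
  Isometry.of_dist_eq fun x y => by rw [dist_eq_norm, dist_eq_norm, norm_secLp_sub]

omit [Fact (1 ≤ p)] in
-- A family of vectors comes from one sequence exactly when its rescaled entries agree across
-- sections. These are closed conditions, so the range is closed and completeness of `ces_p`
-- follows.
theorem range_secLp : Set.range (secLp (p := p)) =
    {f | ∀ (n : ℕ) (k : Fin (n + 1)), ((n : ℂ) + 1) * f n k = ((k : ℂ) + 1) * f k (Fin.last k)} := by
  have h0 : ∀ n : ℕ, (n : ℂ) + 1 ≠ 0 := Nat.cast_add_one_ne_zero
  ext f
  constructor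
  · rintro ⟨x, rfl⟩ n k
    change ((n : ℂ) + 1) * sec x.toSeq n k = ((k : ℂ) + 1) * sec x.toSeq k (Fin.last k)
    rw [sec_apply, sec_apply, mul_inv_cancel_left₀ (h0 n), mul_inv_cancel_left₀ (h0 k),
      Fin.val_last]
  · intro hf
    have h1 : sec (fun m => ((m : ℂ) + 1) * f m (Fin.last m)) = f := by
      funext n
      ext k
      rw [sec_apply, ← hf n k, inv_mul_cancel_left₀ (h0 n)]
    have h2 : (fun m : ℕ => ((m : ℂ) + 1) * f m (Fin.last m)) ∈ cesSubmodule p :=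
      memℓp_sec_iff.1 (h1.symm ▸ f.2)
    exact ⟨⟨_, h2⟩, Subtype.ext h1⟩

theorem continuous_lp_apply (n : ℕ) (k : Fin (n + 1)) :
    Continuous fun f : lp (fun n : ℕ => PiLp 1 fun _ : Fin (n + 1) => ℂ) p => f n k := by
  have h : LipschitzWith 1
      fun f : lp (fun n : ℕ => PiLp 1 fun _ : Fin (n + 1) => ℂ) p => f n k :=
    LipschitzWith.of_dist_le_mul fun f g => by
      rw [NNReal.coe_one, one_mul, dist_eq_norm, dist_eq_norm]
      exact (PiLp.norm_apply_le ((f - g) n) k).trans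
        (lp.norm_apply_le_norm (p_ne_zero p) (f - g) n)
  exact h.continuous

instance : CompleteSpace (Ces p) := by
  rw [completeSpace_iff_isComplete_range isometry_secLp.isUniformInducing, range_secLp]
  refine IsClosed.isComplete ?_
  simp only [Set.ofPred_forall]
  exact isClosed_iInter fun n => isClosed_iInter fun k => isClosed_eq
    ((continuous_lp_apply n k).const_mul _) ((continuous_lp_apply _ _).const_mul _)

/-- The underlying sequence as a linear map. -/
def toSeqLin (p : ℝ≥0∞) : Ces p →ₗ[ℂ] (ℕ → ℂ) := (cesSubmodule p).subtype

/-- Puts `ℓ¹` inside `ces_p`: averages of an `ℓ¹` sequence are `O(1/(n+1))`, which is in `ℓ^p`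
because `p > 1`. -/
theorem mem_of_absAvg_le (hp : 1 < p) {y : ℕ → ℂ} {B : ℝ}
    (hy : ∀ n, absAvg y n ≤ B * (1 / ((n : ℝ) + 1))) : y ∈ cesSubmodule p := by
  have h1 : Memℓp (E := fun _ : ℕ => ℝ) (fun n : ℕ => 1 / ((n : ℝ) + 1)) p := by
    rcases eq_or_ne p ∞ with rfl | hp'
    · exact memℓp_infty tendsto_one_div_add_atTop_nhds_zero_nat.norm.bddAbove_range
    · have hp1 : 1 < p.toReal := by
        rwa [← ENNReal.toReal_one, ENNReal.toReal_lt_toReal ENNReal.one_ne_top hp']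
      refine memℓp_gen ?_
      refine ((summable_nat_add_iff 1).2 (Real.summable_one_div_nat_rpow.2 hp1)).congr fun n => ?_
      rw [Real.norm_of_nonneg (by positivity), Real.div_rpow zero_le_one (by positivity),
        Real.one_rpow]
      push_cast
      rfl
  refine Memℓp.mono (Memℓp.const_smul (𝕜 := ℝ) h1 B) fun n => ?_
  rw [Real.norm_of_nonneg (absAvg_nonneg _ n)]
  exact hy n

theorem norm_le_mul_of_absAvg_le {x y : Ces p} {c : ℝ} (hc : 0 ≤ c)
    (h : ∀ n, absAvg y.toSeq n ≤ c * absAvg x.toSeq n) : ‖y‖ ≤ c * ‖x‖ := by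
  have h1 : ‖c • avg x‖ = c * ‖avg x‖ := by rw [norm_smul, Real.norm_of_nonneg hc]
  rw [norm_def, norm_def, ← h1]
  refine lp.norm_mono (p_ne_zero p) fun n => ?_
  rw [norm_avg_apply]
  exact (h n).trans (Real.le_norm_self _)

theorem isCesaroSolid (hp : 1 < p) : IsCesaroSolid (toSeqLin p) where
  injective := Subtype.val_injective
  solid x y c hc h := by
    have hy : y ∈ cesSubmodule p := Memℓp.mono (c • avg x).2 fun n => by
      rw [Real.norm_of_nonneg (absAvg_nonneg _ n)]
      exact h n
    exact ⟨⟨y, hy⟩, rfl, norm_le_mul_of_absAvg_le hc h⟩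
  summable y hy :=
    let ⟨_, hB⟩ := exists_absAvg_le_of_summable hy
    ⟨⟨y, mem_of_absAvg_le hp hB⟩, rfl⟩

variable {t : ℝ}

theorem norm_le_of_toSeq_eq_genCesaro (ht0 : 0 ≤ t) (ht1 : t < 1) (hp : 1 < p) (hp' : p < ∞)
    {x y : Ces p} (h : y.toSeq = genCesaro t x.toSeq) :
    ‖y‖ ≤ p.toReal / (p.toReal - 1) * ‖x‖ := by
  have hp1 : 1 < p.toReal := by
    rwa [← ENNReal.toReal_one, ENNReal.toReal_lt_toReal ENNReal.one_ne_top hp'.ne]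
  have hq : 0 ≤ p.toReal / (p.toReal - 1) := div_nonneg (by linarith) (by linarith)
  rw [norm_def, norm_def]
  refine lp.norm_le_of_tsum_le (by linarith) (by positivity)
    (Real.tsum_le_of_sum_range_le (fun n => by positivity) fun N => ?_)
  rw [Real.mul_rpow hq (norm_nonneg _)]
  have h1 : ∀ n, ‖avg y n‖ ^ p.toReal ≤
      ((∑ k ∈ Finset.range (n + 1), ‖avg x k‖) / ((n : ℝ) + 1)) ^ p.toReal := fun n => by
    simp only [norm_avg_apply, h]
    exact Real.rpow_le_rpow (absAvg_nonneg _ n) (absAvg_genCesaro_le ht0 ht1 _ n) (by linarith)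
  -- Hardy's inequality is applied to the averages of `x`, not to `x` itself.
  refine (Finset.sum_le_sum fun n _ => h1 n).trans
    ((hardy_inequality hp1 (fun n => norm_nonneg (avg x n)) N).trans ?_)
  gcongr
  exact lp.sum_rpow_le_norm_rpow (by linarith) (avg x) _

theorem absAvg_le_norm (x : Ces p) (n : ℕ) : absAvg x.toSeq n ≤ ‖x‖ := by
  rw [norm_def, ← norm_avg_apply]
  exact lp.norm_apply_le_norm (p_ne_zero p) (avg x) n

theorem norm_le_of_forall_absAvg_le {x : Ces ∞} {c : ℝ} (h : ∀ n, absAvg x.toSeq n ≤ c) :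
    ‖x‖ ≤ c := by
  rw [norm_def]
  exact lp.norm_le_of_forall_le' c fun n => (norm_avg_apply x n).trans_le (h n)

theorem norm_le_of_toSeq_eq_genCesaro_top (ht0 : 0 ≤ t) (ht1 : t < 1)
    {x y : Ces ∞} (h : y.toSeq = genCesaro t x.toSeq) : ‖y‖ ≤ ‖x‖ :=
  norm_le_of_forall_absAvg_le fun n => by
    rw [h]
    exact absAvg_genCesaro_le_of_forall_le ht0 ht1 (absAvg_le_norm x) n

end Ces

/-! ### The space `ces_0` is complete and solid -/

namespace CesZero

theorem isometry_toCesTop : Isometry toCesTop :=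
  AddMonoidHomClass.isometry_of_norm toCesTop fun _ => rfl

theorem range_toCesTop :
    Set.range toCesTop = {x : Ces ∞ | Tendsto (absAvg x.toSeq) atTop (𝓝 0)} := by
  ext x
  exact ⟨by rintro ⟨y, rfl⟩; exact y.2, fun h => ⟨⟨x.toSeq, h⟩, rfl⟩⟩

/-- Uniform approximation: `A_n(x) ≤ A_n(y) + ‖x - y‖`, with `y` in `ces_0` near `x`. -/
theorem isClosed_range_toCesTop : IsClosed (Set.range toCesTop) := by
  rw [range_toCesTop]
  refine isClosed_of_closure_subset fun x hx => ?_
  refine tendsto_order.2 ⟨fun a ha => Eventually.of_forall fun n =>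
    ha.trans_le (absAvg_nonneg _ n), fun ε hε => ?_⟩
  obtain ⟨y, hy, hxy⟩ := Metric.mem_closure_iff.1 hx (ε / 2) (half_pos hε)
  filter_upwards [(show Tendsto (absAvg y.toSeq) atTop (𝓝 0) from hy).eventually_lt_const
    (half_pos hε)] with n hn
  have h1 := absAvg_add_le y.toSeq (x - y).toSeq n
  rw [Ces.toSeq_sub, add_sub_cancel, ← Ces.toSeq_sub] at h1
  have h2 := Ces.absAvg_le_norm (x - y) n
  rw [dist_eq_norm] at hxy
  linarith

instance : CompleteSpace CesZero := by
  rw [completeSpace_iff_isComplete_range isometry_toCesTop.isUniformInducing]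
  exact isClosed_range_toCesTop.isComplete

/-- The underlying sequence as a linear map. -/
def toSeqLin : CesZero →ₗ[ℂ] (ℕ → ℂ) := cesZeroSubmodule.subtype

theorem isCesaroSolid : IsCesaroSolid toSeqLin where
  injective := Subtype.val_injective
  solid x y c hc h := by
    have hx : Tendsto (absAvg (toSeqLin x)) atTop (𝓝 0) := x.2
    have hy : Tendsto (absAvg y) atTop (𝓝 0) :=
      squeeze_zero (absAvg_nonneg y) h (by simpa using hx.const_mul c)
    exact ⟨⟨y, hy⟩, rfl, (Ces.isCesaroSolid ENNReal.one_lt_top).norm_le (x := toCesTop x)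
      (y := toCesTop ⟨y, hy⟩) hc h⟩
  summable y hy := by
    obtain ⟨B, hB⟩ := exists_absAvg_le_of_summable hy
    exact ⟨⟨y, squeeze_zero (absAvg_nonneg y) hB
      (by simpa using tendsto_one_div_add_atTop_nhds_zero_nat.const_mul B)⟩, rfl⟩

end CesZero

end CesaroSeq

/-! ### Assembly for the three spaces -/

theorem propositionP8p2 (t : ℝ) (ht0 : 0 ≤ t) (ht1 : t < 1) :
    (∀ (p : ℝ≥0∞) [Fact (1 ≤ p)], 1 < p → p < ∞ →
      ∃ T : CesaroSeq.Ces p →L[ℂ] CesaroSeq.Ces p,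
        (∀ x : CesaroSeq.Ces p, (T x).toSeq = CesaroSeq.genCesaro t x.toSeq) ∧
        ‖T‖ ≤ min (1 - t)⁻¹ (p.toReal / (p.toReal - 1)) ∧
        IsCompactOperator T ∧
        CesaroSeq.pointSpectrum T = CesaroSeq.Lam ∧
        spectrum ℂ T = CesaroSeq.LamZero ∧
        CesaroSeq.PowerBounded T ∧
        CesaroSeq.UniformlyMeanErgodic T ∧
        ¬ CesaroSeq.Supercyclic T) ∧
    (∃ T : CesaroSeq.CesZero →L[ℂ] CesaroSeq.CesZero,
        (∀ x : CesaroSeq.CesZero, (T x).toSeq = CesaroSeq.genCesaro t x.toSeq) ∧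
        ‖T‖ = 1 ∧
        IsCompactOperator T ∧
        CesaroSeq.pointSpectrum T = CesaroSeq.Lam ∧
        spectrum ℂ T = CesaroSeq.LamZero ∧
        CesaroSeq.PowerBounded T ∧
        CesaroSeq.UniformlyMeanErgodic T ∧
        ¬ CesaroSeq.Supercyclic T) ∧
    (∃ T : CesaroSeq.Ces ∞ →L[ℂ] CesaroSeq.Ces ∞,
        (∀ x : CesaroSeq.Ces ∞, (T x).toSeq = CesaroSeq.genCesaro t x.toSeq) ∧
        ‖T‖ = 1 ∧
        IsCompactOperator T ∧
        CesaroSeq.pointSpectrum T = CesaroSeq.Lam ∧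
        spectrum ℂ T = CesaroSeq.LamZero ∧
        CesaroSeq.PowerBounded T ∧
        CesaroSeq.UniformlyMeanErgodic T ∧
        ¬ CesaroSeq.Supercyclic T) := by
  refine ⟨fun p _ hp hp' => ?_, ?_, ?_⟩
  · obtain ⟨T, hT, hn, -, h⟩ := (CesaroSeq.Ces.isCesaroSolid hp).genCesaro_properties ht0 ht1
    have hp1 : 1 < p.toReal := by
      rwa [← ENNReal.toReal_one, ENNReal.toReal_lt_toReal ENNReal.one_ne_top hp'.ne]
    exact ⟨T, hT, le_min hn (T.opNorm_le_bound (div_nonneg (by linarith) (by linarith)) fun x =>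
      CesaroSeq.Ces.norm_le_of_toSeq_eq_genCesaro ht0 ht1 hp hp' (hT x)), h⟩
  · obtain ⟨T, hT, -, hn, h⟩ := CesaroSeq.CesZero.isCesaroSolid.genCesaro_properties ht0 ht1
    refine ⟨T, hT, le_antisymm (T.opNorm_le_bound zero_le_one fun x => ?_) hn, h⟩
    rw [one_mul]
    exact CesaroSeq.Ces.norm_le_of_toSeq_eq_genCesaro_top ht0 ht1
      (x := CesaroSeq.CesZero.toCesTop x) (y := CesaroSeq.CesZero.toCesTop (T x)) (hT x)
  · obtain ⟨T, hT, -, hn, h⟩ :=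
      (CesaroSeq.Ces.isCesaroSolid ENNReal.one_lt_top).genCesaro_properties ht0 ht1
    refine ⟨T, hT, le_antisymm (T.opNorm_le_bound zero_le_one fun x => ?_) hn, h⟩
    rw [one_mul]
    exact CesaroSeq.Ces.norm_le_of_toSeq_eq_genCesaro_top ht0 ht1 (hT x)
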